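/- Consider a gateway at the origin of $\mathbb{R}^2$ and a device at distance $r_o>0$ from it that transmits with constant power $P>0$. Let the path-loss exponent be $\eta>2$, the noise power $\sigma^2\ge 0$, the inter-device and inter-line spacings $\Delta x,\Delta y>0$, the communication range $R>0$ and the number of devices per gateway $\mathcal N_G\ge 1$ (of which one is active at a time). Packets of $L>0$ bits are split into $m\ge 1$ segments, each sent in a slot of length $T_s>0$ over bandwidth $W>0$ at rate $\mathcal R_m=\frac{L}{mT_s}=\zeta W\log_2(1+\Xi_m)$ with $0<\zeta\le 1$, so that the decoding threshold is $\Xi_m=2^{L/(m\zeta WT_s)}-1$. In the 2-D PPP approximation, the locations $v_1,v_2,\dots$ of the interfering devices form a Poisson point process of constant intensity $\lambda=\frac{1}{\Delta x\,\Delta y\,\mathcal N_G}$ on $\{v\in\mathbb{R}^2:\|v\|\ge \frac{\sqrt3R}{2}\}$. The fading gains $h_o,h_1,h_2,\dots$ are i.i.d. exponential random variables with mean one, independent of the locations. For omni-directional gateways and omni-directional devices (O-GW and O-N, all antenna gains equal to one) with constant power $P$ for all devices, $$\mathrm{SINR}=\frac{P\,h_o\,r_o^{-\eta}}{\sigma^2+\sum_{i\ge1}P\,h_i\,\|v_i\|^{-\eta}},\qquad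 p_m=\mathbb P\{\mathrm{SINR}>\Xi_m\}.$$ Then the series in the denominator converges almost surely, and the segment transmission success probability is $$p_m=\exp\left\{-\frac{\Xi_m r_o^{\eta}\sigma^2}{P}-\frac{2\pi\,\Xi_m r_o^{\eta}\left(\frac{\sqrt3R}{2}\right)^{2-\eta}}{\Delta x\,\Delta y\,\mathcal N_G\,(\eta-2)}\;{}_2F_1\!\left(1,1-\frac2\eta;2-\frac2\eta;\frac{-\Xi_m r_o^{\eta}}{\left(\frac{\sqrt3R}{2}\right)^{\eta}}\right)\right\},$$ where ${}_2F_1(a,b;c;x)$ is the Gauss hypergeometric function, that is, for real $x<1$, the analytic continuation to $(-\infty,1)$ of the series $\sum_{n\ge0}\frac{(a)_n(b)_n}{(c)_n}\frac{x^n}{n!}$. -/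

import Mathlib

open MeasureTheory ProbabilityTheory

noncomputable section

/-! ### Gauss hypergeometric function -/

/-- `F` is a real-analytic continuation to `(-∞, 1)` of the Gauss hypergeometric series
`∑ (a)ₙ (b)ₙ / (c)ₙ · xⁿ / n!`, which converges for `|x| < 1`. -/
def IsHypergeometricContinuation (a b c : ℝ) (F : ℝ → ℝ) : Prop :=
  AnalyticOnNhd ℝ F (Set.Iio 1) ∧
    ∀ x : ℝ, |x| < 1 → F x = ordinaryHypergeometric a b c x

/-- Two analytic continuations of the hypergeometric series agree on `(-∞, 1)`. -/
theorem IsHypergeometricContinuation.eqOn {a b c : ℝ} {F G : ℝ → ℝ}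
    (hF : IsHypergeometricContinuation a b c F) (hG : IsHypergeometricContinuation a b c G) :
    Set.EqOn F G (Set.Iio 1) := by
  refine hF.1.eqOn_of_preconnected_of_eventuallyEq hG.1 isPreconnected_Iio
    (z₀ := 0) (by simp) ?_
  filter_upwards [Metric.ball_mem_nhds (0 : ℝ) one_pos] with x hx
  have hx' : |x| < 1 := by simpa using hx
  rw [hF.2 x hx', hG.2 x hx']

open Classical in
/-- The Gauss hypergeometric function `₂F₁(a, b; c; x)` for real parameters and real `x < 1`
(principal branch): the analytic continuation of the hypergeometric series to `(-∞, 1)`. Mathlib's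
`ordinaryHypergeometric` is the sum of the series, hence meaningful only for `|x| < 1`. -/
def gaussHypergeometric (a b c x : ℝ) : ℝ :=
  if h : ∃ F : ℝ → ℝ, IsHypergeometricContinuation a b c F then h.choose x else 0

/-- Any analytic continuation computes the Gauss hypergeometric function. -/
theorem IsHypergeometricContinuation.gaussHypergeometric_eq {a b c : ℝ} {F : ℝ → ℝ}
    (hF : IsHypergeometricContinuation a b c F) {x : ℝ} (hx : x < 1) :
    gaussHypergeometric a b c x = F x := by
  have h : ∃ F : ℝ → ℝ, IsHypergeometricContinuation a b c F := ⟨F, hF⟩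
  rw [gaussHypergeometric, dif_pos h]
  exact h.choose_spec.eqOn hF hx

/-! ### Poisson point processes -/

/-- The number of indices `i` with `X i ω ∈ B`. -/
def pointCount {Ω E : Type*} (X : ℕ → Ω → E) (B : Set E) (ω : Ω) : ℕ∞ :=
  {i : ℕ | X i ω ∈ B}.encard

/-- The random points `X 0, X 1, X 2, …` enumerate, under `μ`, a Poisson point process on `E` with
intensity measure `Λ` (of infinite total mass): the number of points in a measurable set `B` of
finite intensity is Poisson distributed with mean `Λ B`, and the numbers of points in finitely many
pairwise disjoint measurable sets are independent. -/
structure IsPoissonPointProcess {Ω E : Type*} [MeasurableSpace Ω] [MeasurableSpace E]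
    (X : ℕ → Ω → E) (Λ : Measure E) (μ : Measure Ω) : Prop where
  measurable : ∀ i, Measurable (X i)
  hasLaw_count : ∀ B : Set E, MeasurableSet B → Λ B ≠ ⊤ →
    HasLaw (pointCount X B) ((poissonMeasure (Λ B).toNNReal).map (Nat.cast : ℕ → ℕ∞)) μ
  indep_count : ∀ (n : ℕ) (B : Fin n → Set E), (∀ k, MeasurableSet (B k)) →
    Pairwise (fun j k => Disjoint (B j) (B k)) → iIndepFun (fun k => pointCount X (B k)) μ

/-! ### The network model -/

/-- The plane, with its Euclidean norm and Lebesgue measure. -/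
abbrev Plane : Type := EuclideanSpace ℝ (Fin 2)

/-- The SINR threshold `Ξ = 2 ^ (L / (m ζ W Tₛ)) - 1` at which the rate `L / (m Tₛ)` of a segment
equals `ζ W log₂ (1 + Ξ)`. -/
def sinrThreshold (L : ℝ) (m : ℕ) (ζ W Ts : ℝ) : ℝ :=
  (2 : ℝ) ^ (L / (m * ζ * W * Ts)) - 1

/-- The density of simultaneously active devices: the devices have density `1 / (Δx Δy)`, and one
out of the `NG` devices of each gateway is active. -/
def activeDensity (Δx Δy : ℝ) (NG : ℕ) : ℝ := 1 / (Δx * Δy * NG)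

/-- Intensity measure of the interferers in the 2-D PPP approximation: homogeneous of density
`lam`, outside the interference-free disc of radius `√3 R / 2` around the test gateway. -/
def interfererIntensity (lam R : ℝ) : Measure Plane :=
  ENNReal.ofReal lam • (volume : Measure Plane).restrict {v | √3 * R / 2 ≤ ‖v‖}

/-- The 2-D PPP approximation. The test gateway is at the origin, `X i` is the location of the
`i`-th interferer, `h none` the fading gain of the intended link, and `h (some i)` the fading gain
of the link from the `i`-th interferer. The fading gains are i.i.d. exponential of mean one, and
independent of the locations. -/
structure IsTwoDimPPPModel {Ω : Type*} [MeasurableSpace Ω] (μ : Measure Ω) (lam R : ℝ)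
    (X : ℕ → Ω → Plane) (h : Option ℕ → Ω → ℝ) : Prop where
  locations : IsPoissonPointProcess X (interfererIntensity lam R) μ
  fading_law : ∀ k, HasLaw (h k) (expMeasure 1) μ
  fading_indep : iIndepFun h μ
  fading_indep_locations : IndepFun (fun ω k => h k ω) (fun ω i => X i ω) μ

/-- Power received at the test gateway from the `i`-th interferer, for omni-directional antennas
(unit gains) and constant transmission power `P`. -/
def interferencePower {Ω : Type*} (P η : ℝ) (X : ℕ → Ω → Plane) (h : Option ℕ → Ω → ℝ)
    (ω : Ω) (i : ℕ) : ℝ :=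
  P * h (some i) ω * ‖X i ω‖ ^ (-η)

/-- The signal-to-interference-plus-noise ratio at the test gateway for omni-directional gateways
and devices, constant transmission power `P`, noise power `σ ^ 2` and intended link distance
`ro`. -/
def sinr {Ω : Type*} (P η σ ro : ℝ) (X : ℕ → Ω → Plane) (h : Option ℕ → Ω → ℝ) (ω : Ω) : ℝ :=
  (P * h none ω * ro ^ (-η)) / (σ ^ 2 + ∑' i, interferencePower P η X h ω i)

/-- The segment transmission success probability: the probability that the SINR exceeds `Ξ`. -/
def successProb {Ω : Type*} [MeasurableSpace Ω] (μ : Measure Ω) (P η σ ro Ξ : ℝ)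
    (X : ℕ → Ω → Plane) (h : Option ℕ → Ω → ℝ) : ℝ :=
  μ.real {ω | Ξ < sinr P η σ ro X h ω}

end

open scoped ENNReal NNReal Topology
open Filter

noncomputable section

/-! With `T = Ξ ro ^ η`, `A = T σ² / P` and normalized interference `J = ∑ hᵢ ‖vᵢ‖ ^ (-η)`, the
event `SINR > Ξ` is `hₒ > A + T J`. Since `hₒ` is exponential and independent of `J`, its
probability is `e^(-A) E[e^(-T J)]` (`fadingMeasure_lt`).

Averaging over the fading first turns `e^(-T J)` into `∏ 1 / (1 + cᵢ) = exp (-∑ log (1 + cᵢ))`,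
where `cᵢ = T ‖vᵢ‖ ^ (-η)`. The Laplace functional of the Poisson process
(`IsPoissonPointProcess.laplace`) turns the mean of this into `exp (-∫ c / (1 + c) dΛ)`. In polar
coordinates, scaled by `a = √3 R / 2`, the exponent becomes `∫ t ^ (1 - η) / (1 - x t ^ (-η))` over
`t > 1` with `x = -T / a ^ η`. Times `η - 2`, this is analytic for `x < 1` and expands into the
hypergeometric series for `|x| < 1` (`isHypergeometricContinuation_integral`).

Everything is computed in `[0, ∞]` with `e^(-∞) = 0`, so no convergence of `J` is presupposed. Its
almost sure finiteness comes out of the same formula, because `E[e^(-T J)] → 1` as `T → 0`. -/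

/-! ### The decreasing exponential on `[0, ∞]` -/

/-- The function `x ↦ exp (-x)` on `[0, ∞]`, with value `0` at `∞`. -/
def negExp (x : ℝ≥0∞) : ℝ≥0∞ := EReal.exp (-(x : EReal))

@[simp] lemma negExp_zero : negExp 0 = 1 := by simp [negExp]

@[simp] lemma negExp_top : negExp ⊤ = 0 := by simp [negExp]

lemma negExp_ofReal {x : ℝ} (hx : 0 ≤ x) :
    negExp (ENNReal.ofReal x) = ENNReal.ofReal (Real.exp (-x)) := by
  rw [negExp, EReal.coe_ennreal_ofReal, max_eq_left hx, ← EReal.coe_neg, EReal.exp_coe]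

lemma continuous_negExp : Continuous negExp :=
  EReal.expHomeomorph.continuous.comp (continuous_neg.comp continuous_coe_ennreal_ereal)

@[fun_prop] lemma measurable_negExp : Measurable negExp := continuous_negExp.measurable

lemma negExp_antitone : Antitone negExp := fun _ _ hxy =>
  EReal.exp_monotone (EReal.neg_le_neg_iff.2 (EReal.coe_ennreal_le_coe_ennreal_iff.2 hxy))

lemma negExp_le_one (x : ℝ≥0∞) : negExp x ≤ 1 := by
  simpa using negExp_antitone (zero_le (a := x))

lemma negExp_add (x y : ℝ≥0∞) : negExp (x + y) = negExp x * negExp y := by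
  rw [negExp, negExp, negExp, ← EReal.exp_add, EReal.coe_ennreal_add, EReal.neg_add, sub_eq_add_neg]
  · left; exact EReal.coe_ennreal_ne_bot _
  · right; exact EReal.coe_ennreal_ne_bot _

lemma negExp_sum {ι : Type*} (s : Finset ι) (f : ι → ℝ≥0∞) :
    negExp (∑ i ∈ s, f i) = ∏ i ∈ s, negExp (f i) := by
  classical
  induction s using Finset.induction_on with
  | empty => simp
  | insert a s ha ih => rw [Finset.sum_insert ha, Finset.prod_insert ha, negExp_add, ih]

lemma negExp_mul_natCast (x : ℝ≥0∞) (n : ℕ) : negExp (x * n) = negExp x ^ n := by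
  have := negExp_sum (Finset.range n) (fun _ => x)
  simpa [mul_comm] using this

/-! ### The Laplace functional of a Poisson point process -/

/-- The Poisson probability generating function, summed by the exponential series. The bound `q ≤ 1`
keeps the truncated subtraction `1 - q` exact. -/
lemma lintegral_pow_poissonMeasure (r : ℝ≥0) (q : ℝ≥0∞) (hq : q ≤ 1) :
    ∫⁻ n, q ^ n ∂(poissonMeasure r) = negExp (r * (1 - q)) := by
  lift q to ℝ≥0 using (hq.trans_lt ENNReal.one_lt_top).ne
  have hq' : (q : ℝ) ≤ 1 := by exact_mod_cast hq
  have hs : HasSum (fun n : ℕ => Real.exp (-r) * ((r * q : ℝ) ^ n / n.factorial))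
      (Real.exp (-r) * Real.exp (r * q)) := by
    refine HasSum.mul_left _ ?_
    rw [Real.exp_eq_exp_ℝ]
    exact NormedSpace.expSeries_div_hasSum_exp (r * q : ℝ)
  have h1 : ∫⁻ n, (q : ℝ≥0∞) ^ n ∂(poissonMeasure r)
      = ∑' n : ℕ, ENNReal.ofReal (Real.exp (-r) * ((r * q : ℝ) ^ n / n.factorial)) := by
    rw [poissonMeasure, lintegral_sum_measure]
    congr 1 with n
    rw [lintegral_smul_measure, lintegral_dirac, smul_eq_mul]
    have : (q : ℝ≥0∞) ^ n = ENNReal.ofReal ((q : ℝ) ^ n) := by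
      rw [ENNReal.ofReal_pow q.coe_nonneg, ENNReal.ofReal_coe_nnreal]
    rw [this, ← ENNReal.ofReal_mul (by positivity)]
    congr 1
    rw [mul_pow]; ring
  rw [h1, ← ENNReal.ofReal_tsum_of_nonneg (fun n => by positivity) hs.summable, hs.tsum_eq,
    ← Real.exp_add]
  have h2 : (r : ℝ≥0∞) * (1 - q) = ENNReal.ofReal (r * (1 - q)) := by
    rw [ENNReal.ofReal_mul r.coe_nonneg, ENNReal.ofReal_coe_nnreal, ENNReal.ofReal_sub _ q.coe_nonneg]
    simp
  rw [h2, negExp_ofReal (mul_nonneg r.coe_nonneg (by linarith))]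
  congr 2; ring

lemma tendsto_tsum_of_monotone {f : ℕ → ℕ → ℝ≥0∞} {g : ℕ → ℝ≥0∞} (hf : ∀ i, Monotone fun n => f n i)
    (h : ∀ i, Tendsto (fun n => f n i) atTop (𝓝 (g i))) :
    Tendsto (fun n => ∑' i, f n i) atTop (𝓝 (∑' i, g i)) := by
  simp_rw [← lintegral_count]
  exact lintegral_tendsto_of_tendsto_of_monotone (fun n => measurable_from_top.aemeasurable)
    (ae_of_all _ hf) (ae_of_all _ h)

lemma indicator_simpleFunc_eq_sum {E : Type*} [MeasurableSpace E] (f : SimpleFunc E ℝ≥0∞) (S : Set E) (v : E) :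
    S.indicator f v = ∑ y : f.range, (f ⁻¹' {(y : ℝ≥0∞)} ∩ S).indicator (fun _ => (y : ℝ≥0∞)) v := by
  classical
  rw [Finset.sum_coe_sort f.range (fun y => (f ⁻¹' {y} ∩ S).indicator (fun _ => y) v)]
  by_cases hv : v ∈ S
  · rw [Set.indicator_of_mem hv, Finset.sum_eq_single (f v)]
    · rw [Set.indicator_of_mem (show v ∈ f ⁻¹' {f v} ∩ S from ⟨rfl, hv⟩)]
    · intro y _ hy
      exact Set.indicator_of_notMem (fun h => hy h.1.symm) _
    · intro h; exact absurd (SimpleFunc.mem_range_self f v) h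
  · rw [Set.indicator_of_notMem hv, Finset.sum_eq_zero]
    intro y _
    exact Set.indicator_of_notMem (fun h => hv h.2) _

/-- Turns sums over points into counts, the only quantities whose law the definition of a Poisson
process prescribes. -/
lemma tsum_indicator_const {Ω E : Type*} (X : ℕ → Ω → E) (B : Set E) (c : ℝ≥0∞) (ω : Ω) :
    ∑' i, B.indicator (fun _ => c) (X i ω) = c * (pointCount X B ω : ℝ≥0∞) := by
  rw [pointCount, mul_comm, ← ENNReal.tsum_set_const, tsum_subtype {i | X i ω ∈ B} fun _ => c]
  rfl

section PointProcess

variable {Ω E : Type*} [MeasurableSpace Ω] [MeasurableSpace E] {X : ℕ → Ω → E} {Λ : Measure E}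
  {μ : Measure Ω}

lemma IsPoissonPointProcess.lintegral_negExp_count (hX : IsPoissonPointProcess X Λ μ) {B : Set E}
    (hB : MeasurableSet B) (hΛ : Λ B ≠ ⊤) (c : ℝ≥0∞) :
    ∫⁻ ω, negExp (c * (pointCount X B ω : ℝ≥0∞)) ∂μ = negExp (Λ B * (1 - negExp c)) := by
  have hm : Measurable (fun n : ℕ∞ => negExp (c * (n : ℝ≥0∞))) := measurable_from_top
  rw [(hX.hasLaw_count B hB hΛ).lintegral_comp (f := fun n : ℕ∞ => negExp (c * (n : ℝ≥0∞)))
    hm.aemeasurable, lintegral_map hm measurable_from_top]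
  simp only [ENat.toENNReal_coe, negExp_mul_natCast]
  rw [lintegral_pow_poissonMeasure _ _ (negExp_le_one c), ENNReal.coe_toNNReal hΛ]

/-- `HasLaw` only yields almost everywhere measurability of a count; a sum of indicators of the
measurable points gives the full statement, with no finiteness of the intensity. -/
lemma IsPoissonPointProcess.measurable_pointCount (hX : IsPoissonPointProcess X Λ μ) {B : Set E}
    (hB : MeasurableSet B) : Measurable fun ω => (pointCount X B ω : ℝ≥0∞) := by
  have : (fun ω => (pointCount X B ω : ℝ≥0∞)) =
      fun ω => ∑' i, B.indicator (fun _ => (1 : ℝ≥0∞)) (X i ω) := by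
    ext ω; rw [tsum_indicator_const, one_mul]
  rw [this]
  exact Measurable.tsum fun i => (measurable_const.indicator hB).comp (hX.measurable i)

lemma IsPoissonPointProcess.indep_count_fintype (hX : IsPoissonPointProcess X Λ μ) {ι : Type*}
    [Fintype ι] (B : ι → Set E) (hB : ∀ k, MeasurableSet (B k))
    (hd : Pairwise fun j k => Disjoint (B j) (B k)) :
    iIndepFun (fun k => pointCount X (B k)) μ := by
  let e := (Fintype.equivFin ι).symm
  refine iIndepFun.of_precomp e.surjective (hX.indep_count _ (fun k => B (e k)) (fun k => hB _) ?_)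
  exact fun j k hjk => hd (e.injective.ne hjk)

/-- On the fibres of `f` inside `S` the sum over the points is a weighted sum of independent Poisson
counts, so the expectation factors into generating functions. Finite intensity of `S` is what makes
the law of each count available. -/
lemma IsPoissonPointProcess.laplace_simpleFunc (hX : IsPoissonPointProcess X Λ μ)
    (f : SimpleFunc E ℝ≥0∞) {S : Set E} (hS : MeasurableSet S) (hΛ : Λ S ≠ ⊤) :
    ∫⁻ ω, negExp (∑' i, S.indicator f (X i ω)) ∂μ
      = negExp (∫⁻ v, (1 - negExp (S.indicator f v)) ∂Λ) := by
  let B : f.range → Set E := fun y => f ⁻¹' {(y : ℝ≥0∞)} ∩ S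
  have hB : ∀ y, MeasurableSet (B y) := fun y => (f.measurableSet_fiber _).inter hS
  have hBΛ : ∀ y, Λ (B y) ≠ ⊤ := fun y => measure_ne_top_of_subset Set.inter_subset_right hΛ
  have hd : Pairwise fun j k => Disjoint (B j) (B k) := by
    intro j k hjk
    refine Set.disjoint_left.2 fun v hj hk => hjk (Subtype.ext ?_)
    exact (hj.1 : f v = j).symm.trans hk.1
  have h1 : ∀ ω, negExp (∑' i, S.indicator f (X i ω))
      = ∏ y : f.range, negExp ((y : ℝ≥0∞) * (pointCount X (B y) ω : ℝ≥0∞)) := by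
    intro ω
    rw [← negExp_sum]
    simp_rw [indicator_simpleFunc_eq_sum f S]
    rw [Summable.tsum_finsetSum (fun _ _ => ENNReal.summable)]
    simp_rw [tsum_indicator_const]
    rfl
  have h2 : ∀ v, 1 - negExp (S.indicator f v)
      = ∑ y : f.range, (B y).indicator (fun _ => 1 - negExp (y : ℝ≥0∞)) v := by
    intro v
    by_cases hv : v ∈ S
    · rw [Set.indicator_of_mem hv, Finset.sum_eq_single ⟨f v, SimpleFunc.mem_range_self f v⟩]
      · rw [Set.indicator_of_mem (show v ∈ B ⟨f v, SimpleFunc.mem_range_self f v⟩ from ⟨rfl, hv⟩)]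
      · intro y _ hy
        exact Set.indicator_of_notMem (fun h => hy (Subtype.ext h.1.symm)) _
      · intro h; exact absurd (Finset.mem_univ _) h
    · rw [Set.indicator_of_notMem hv, Finset.sum_eq_zero]
      · simp
      · intro y _
        exact Set.indicator_of_notMem (fun h => hv h.2) _
  simp_rw [h1, h2]
  have hind : iIndepFun (fun (y : f.range) ω => negExp ((y : ℝ≥0∞) * (pointCount X (B y) ω : ℝ≥0∞))) μ :=
    (hX.indep_count_fintype B hB hd).comp (fun y (n : ℕ∞) => negExp ((y : ℝ≥0∞) * (n : ℝ≥0∞)))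
      (fun y => measurable_from_top)
  rw [lintegral_prod_eq_prod_lintegral_of_indepFun _ _ hind fun y =>
    measurable_negExp.comp ((hX.measurable_pointCount (hB y)).const_mul _)]
  rw [lintegral_finsetSum _ fun y _ => measurable_const.indicator (hB y), negExp_sum]
  refine Finset.prod_congr rfl fun y _ => ?_
  rw [hX.lintegral_negExp_count (hB y) (hBΛ y), lintegral_indicator_const (hB y), mul_comm]

/-- The Laplace functional of a Poisson point process. -/
theorem IsPoissonPointProcess.laplace [IsProbabilityMeasure μ] [SigmaFinite Λ]
    (hX : IsPoissonPointProcess X Λ μ) {φ : E → ℝ≥0∞} (hφ : Measurable φ) :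
    ∫⁻ ω, negExp (∑' i, φ (X i ω)) ∂μ = negExp (∫⁻ v, (1 - negExp (φ v)) ∂Λ) := by
  -- Simple functions cut off to sets of finite intensity, increasing to `φ`. The left side then
  -- passes to the limit by domination by `1`, the right side by monotone convergence.
  let g : ℕ → E → ℝ≥0∞ := fun n => (spanningSets Λ n).indicator (SimpleFunc.eapprox φ n)
  have hgm : ∀ n, Measurable (g n) := fun n =>
    (SimpleFunc.measurable _).indicator (measurableSet_spanningSets Λ n)
  have hmono : ∀ v, Monotone fun n => g n v := by
    intro v m n hmn
    refine (Set.indicator_le_indicator (SimpleFunc.monotone_eapprox φ hmn v)).trans ?_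
    exact Set.indicator_le_indicator_of_subset (monotone_spanningSets Λ hmn) (fun _ => zero_le) v
  have hlim : ∀ v, Tendsto (fun n => g n v) atTop (𝓝 (φ v)) := by
    intro v
    have h1 : Tendsto (fun n => SimpleFunc.eapprox φ n v) atTop (𝓝 (φ v)) := by
      rw [← SimpleFunc.iSup_eapprox_apply hφ v]
      exact tendsto_atTop_iSup fun m n hmn => SimpleFunc.monotone_eapprox φ hmn v
    refine h1.congr' ?_
    filter_upwards [eventually_mem_spanningSets Λ v] with n hn
    exact (Set.indicator_of_mem hn _).symm
  have hL : Tendsto (fun n => ∫⁻ ω, negExp (∑' i, g n (X i ω)) ∂μ) atTop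
      (𝓝 (∫⁻ ω, negExp (∑' i, φ (X i ω)) ∂μ)) := by
    refine tendsto_lintegral_of_dominated_convergence (fun _ => 1) (fun n => ?_)
      (fun n => ae_of_all _ fun ω => negExp_le_one _) (by simp) (ae_of_all _ fun ω => ?_)
    · exact measurable_negExp.comp (Measurable.tsum fun i => (hgm n).comp (hX.measurable i))
    · exact (continuous_negExp.tendsto _).comp
        (tendsto_tsum_of_monotone (fun i => hmono _) fun i => hlim _)
  have hR : Tendsto (fun n => negExp (∫⁻ v, (1 - negExp (g n v)) ∂Λ)) atTop
      (𝓝 (negExp (∫⁻ v, (1 - negExp (φ v)) ∂Λ))) := by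
    refine (continuous_negExp.tendsto _).comp (lintegral_tendsto_of_tendsto_of_monotone
      (fun n => (measurable_const.sub (measurable_negExp.comp (hgm n))).aemeasurable)
      (ae_of_all _ fun v m n hmn => tsub_le_tsub_left (negExp_antitone (hmono v hmn)) _)
      (ae_of_all _ fun v => ?_))
    exact ENNReal.Tendsto.sub tendsto_const_nhds ((continuous_negExp.tendsto _).comp (hlim v))
      (Or.inl ENNReal.one_ne_top)
  refine tendsto_nhds_unique hL (hR.congr fun n => ?_)
  exact (hX.laplace_simpleFunc _ (measurableSet_spanningSets Λ n)
    (measure_spanningSets_lt_top Λ n).ne).symm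

end PointProcess

/-! ### Exponential fading -/

/-- The exponential tail, with the threshold `⊤` allowed so that infinite interference needs no
separate treatment. -/
lemma expMeasure_lt (y : ℝ≥0∞) : expMeasure 1 {x | y < ENNReal.ofReal x} = negExp y := by
  have := isProbabilityMeasure_expMeasure one_pos
  rcases eq_or_ne y ⊤ with rfl | hy
  · simp
  · lift y to ℝ≥0 using hy
    have h1 : {x : ℝ | (y : ℝ≥0∞) < ENNReal.ofReal x} = (Set.Iic (y : ℝ))ᶜ := by
      ext x
      simp only [Set.mem_ofPred_eq, Set.mem_compl_iff, Set.mem_Iic, not_le]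
      rw [← ENNReal.ofReal_coe_nnreal, ENNReal.ofReal_lt_ofReal_iff']
      exact ⟨fun h => h.1, fun h => ⟨h, y.coe_nonneg.trans_lt h⟩⟩
    have h2 := cdf_expMeasure_eq (r := 1) one_pos (y : ℝ)
    rw [cdf_eq_real, if_pos y.coe_nonneg, one_mul] at h2
    have h3 : (expMeasure 1).real (Set.Iic (y : ℝ))ᶜ = Real.exp (-y) := by
      rw [measureReal_compl measurableSet_Iic, h2]; simp
    rw [h1, ← ofReal_measureReal, h3, ← negExp_ofReal y.coe_nonneg, ENNReal.ofReal_coe_nnreal]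

/-- The Laplace transform `1 / (1 + c)` is written as `exp (-log (1 + c))` so that products over
interferers become sums over points, as the Laplace functional requires. -/
lemma lintegral_negExp_mul_expMeasure {c : ℝ} (hc : 0 ≤ c) :
    ∫⁻ x, negExp (ENNReal.ofReal (x * c)) ∂(expMeasure 1)
      = negExp (ENNReal.ofReal (Real.log (1 + c))) := by
  have hc1 : 0 < 1 + c := by linarith
  have hm : Measurable fun x : ℝ => negExp (ENNReal.ofReal (x * c)) := by fun_prop
  have hpdf : Measurable (exponentialPDF 1) :=
    (measurable_exponentialPDFReal 1).ennreal_ofReal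
  have hpdf' : Measurable (exponentialPDF (1 + c)) :=
    (measurable_exponentialPDFReal _).ennreal_ofReal
  have h0 : ∫⁻ x, negExp (ENNReal.ofReal (x * c)) ∂(expMeasure 1)
      = ∫⁻ x, exponentialPDF 1 x * negExp (ENNReal.ofReal (x * c)) := by
    change ∫⁻ x, negExp (ENNReal.ofReal (x * c)) ∂(volume.withDensity (exponentialPDF 1)) = _
    rw [lintegral_withDensity_eq_lintegral_mul _ hpdf hm]
    rfl
  -- Exponential tilting: `e^(-x) e^(-c x)` is the density of rate `1 + c` up to the factor `1 / (1
  -- + c)`.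
  have h1 : ∀ x : ℝ, exponentialPDF 1 x * negExp (ENNReal.ofReal (x * c))
      = ENNReal.ofReal (1 / (1 + c)) * exponentialPDF (1 + c) x := by
    intro x
    rcases lt_or_ge x 0 with hx | hx
    · rw [exponentialPDF_of_neg hx, exponentialPDF_of_neg hx, zero_mul, mul_zero]
    · rw [exponentialPDF_of_nonneg hx, exponentialPDF_of_nonneg hx, negExp_ofReal (by positivity),
        ← ENNReal.ofReal_mul (by positivity), ← ENNReal.ofReal_mul (by positivity)]
      congr 1
      rw [mul_assoc, ← Real.exp_add, ← mul_assoc, one_div_mul_cancel hc1.ne']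
      congr 2; ring
  rw [h0]
  simp_rw [h1]
  rw [lintegral_const_mul _ hpdf', lintegral_exponentialPDF_eq_one hc1, mul_one,
    negExp_ofReal (Real.log_nonneg (by linarith)), Real.exp_neg, Real.exp_log hc1, one_div]

instance : IsProbabilityMeasure (expMeasure 1) := isProbabilityMeasure_expMeasure one_pos

/-- The joint law of a sequence of i.i.d. exponential fading gains of mean one, and of the
fading gain of the intended link. -/
def fadingMeasure : Measure (Option ℕ → ℝ) := Measure.infinitePi fun _ => expMeasure 1

instance : IsProbabilityMeasure fadingMeasure := by unfold fadingMeasure; infer_instance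

lemma iIndepFun_fadingMeasure : iIndepFun (fun k (f : Option ℕ → ℝ) => f k) fadingMeasure :=
  iIndepFun_infinitePi (X := fun _ x => x) fun _ => measurable_id

lemma map_fadingMeasure (k : Option ℕ) : fadingMeasure.map (fun f => f k) = expMeasure 1 :=
  Measure.infinitePi_map_eval _ k

/-- Independence settles finitely many interferers; the partial sums then converge in `[0, ∞]` and
`negExp ≤ 1` dominates. -/
lemma lintegral_fading_interference {c : ℕ → ℝ} (hc : ∀ i, 0 ≤ c i) :
    ∫⁻ f, negExp (∑' i, ENNReal.ofReal (f (some i) * c i)) ∂fadingMeasure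
      = negExp (∑' i, ENNReal.ofReal (Real.log (1 + c i))) := by
  have hm : ∀ i, Measurable fun x : ℝ => negExp (ENNReal.ofReal (x * c i)) := fun i => by fun_prop
  have hfin : ∀ n : ℕ, ∫⁻ f, negExp (∑ i ∈ Finset.range n, ENNReal.ofReal (f (some i) * c i))
      ∂fadingMeasure = negExp (∑ i ∈ Finset.range n, ENNReal.ofReal (Real.log (1 + c i))) := by
    intro n
    simp_rw [negExp_sum]
    have hind : iIndepFun (fun (i : ℕ) (f : Option ℕ → ℝ) =>
        negExp (ENNReal.ofReal (f (some i) * c i))) fadingMeasure :=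
      (iIndepFun_fadingMeasure.precomp (Option.some_injective ℕ)).comp
        (fun i x => negExp (ENNReal.ofReal (x * c i))) hm
    rw [lintegral_prod_eq_prod_lintegral_of_indepFun _ _ hind
      fun i => (hm i).comp (measurable_pi_apply _)]
    refine Finset.prod_congr rfl fun i _ => ?_
    rw [← lintegral_negExp_mul_expMeasure (hc i), ← map_fadingMeasure (some i),
      lintegral_map (hm i) (measurable_pi_apply _)]
  have htend : ∀ g : ℕ → ℝ≥0∞, Tendsto (fun n => negExp (∑ i ∈ Finset.range n, g i)) atTop
      (𝓝 (negExp (∑' i, g i))) := fun g =>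
    (continuous_negExp.tendsto _).comp ENNReal.summable.hasSum.tendsto_sum_nat
  refine tendsto_nhds_unique (tendsto_lintegral_of_dominated_convergence (fun _ => 1)
    (fun n => ?_) (fun n => ae_of_all _ fun ω => negExp_le_one _) (by simp)
    (ae_of_all _ fun f => htend _)) ((htend _).congr fun n => (hfin n).symm)
  fun_prop

lemma indepFun_fadingMeasure :
    IndepFun (fun f : Option ℕ → ℝ => f none) (fun f i => f (some i)) fadingMeasure := by
  have h := indep_iSup_of_disjoint (fun k => (measurable_pi_apply k).comap_le)
    iIndepFun_fadingMeasure.iIndep (S := {none}) (T := Set.range some)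
    (by simp)
  refine indep_of_indep_of_le_left (indep_of_indep_of_le_right h ?_) ?_
  · rw [← measurable_iff_comap_le]
    refine @measurable_pi_lambda _ _ _ (_) _ _ fun i => ?_
    rw [measurable_iff_comap_le]
    exact le_iSup₂_of_le (f := fun (k : Option ℕ) (_ : k ∈ Set.range some) =>
      MeasurableSpace.comap (fun f : Option ℕ → ℝ => f k) _) (some i) ⟨i, rfl⟩ le_rfl
  · exact le_iSup₂_of_le (f := fun (k : Option ℕ) (_ : k ∈ ({none} : Set (Option ℕ))) =>
      MeasurableSpace.comap (fun f : Option ℕ → ℝ => f k) _) none rfl le_rfl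

/-- Conditionally on the other gains, the intended gain exceeds `Y` with probability `e^(-Y)`. This
is where exponential fading converts a success probability into a Laplace transform. -/
lemma fadingMeasure_lt {Y : (ℕ → ℝ) → ℝ≥0∞} (hY : Measurable Y) :
    fadingMeasure {f | Y (fun i => f (some i)) < ENNReal.ofReal (f none)}
      = ∫⁻ f, negExp (Y fun i => f (some i)) ∂fadingMeasure := by
  have hs : Measurable fun (f : Option ℕ → ℝ) (i : ℕ) => f (some i) := by fun_prop
  have hpair := (indepFun_iff_map_prod_eq_prod_map_map (hs.aemeasurable)
    (measurable_pi_apply none).aemeasurable).1 indepFun_fadingMeasure.symm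
  have hset : MeasurableSet {p : (ℕ → ℝ) × ℝ | Y p.1 < ENNReal.ofReal p.2} :=
    measurableSet_lt (by fun_prop) (by fun_prop)
  have h1 : {f : Option ℕ → ℝ | Y (fun i => f (some i)) < ENNReal.ofReal (f none)}
      = (fun f : Option ℕ → ℝ => ((fun i => f (some i)), f none)) ⁻¹'
        {p : (ℕ → ℝ) × ℝ | Y p.1 < ENNReal.ofReal p.2} := rfl
  rw [h1, ← Measure.map_apply (hs.prodMk (measurable_pi_apply none)) hset, hpair,
    Measure.prod_apply hset, ← lintegral_map (f := fun g => negExp (Y g)) (by fun_prop) hs]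
  refine lintegral_congr fun g => ?_
  rw [map_fadingMeasure]
  exact expMeasure_lt (Y g)

/-! ### An integral representation of the hypergeometric function -/

section ParametricIntegral

variable {α : Type*} [MeasurableSpace α]

/-- The real part is at least `1 - (1 - δ) u ≥ δ`, a bound uniform in `u` that keeps the
denominators away from zero. -/
lemma min_one_le_norm_one_sub_mul {δ u : ℝ} {z : ℂ} (hδ1 : δ ≤ 1) (hz : z.re ≤ 1 - δ)
    (hu : u ∈ Set.Icc (0 : ℝ) 1) : δ ≤ ‖1 - z * u‖ := by
  refine le_trans ?_ (Complex.re_le_norm _)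
  have : (1 - z * u).re = 1 - z.re * u := by simp
  rw [this]
  nlinarith [hu.1, hu.2, mul_le_mul_of_nonneg_right hz hu.1, mul_nonneg (sub_nonneg.2 hδ1) (sub_nonneg.2 hu.2)]

/-- Differentiation under the integral sign. Working over `ℂ` makes differentiability sufficient for
analyticity. -/
lemma differentiableOn_integral_div_one_sub_mul {ν : Measure α} {w u : α → ℝ} (hw : Integrable w ν)
    (hu : Measurable u) (hu01 : ∀ᵐ t ∂ν, u t ∈ Set.Icc (0 : ℝ) 1) :
    DifferentiableOn ℂ (fun z : ℂ => ∫ t, (w t : ℂ) / (1 - z * u t) ∂ν) {z | z.re < 1} := by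
  intro z₀ hz₀
  have hz₀ : z₀.re < 1 := hz₀
  -- Half the distance from `z₀` to the line `Re z = 1`, capped at `1`, leaves a neighbourhood of
  -- `z₀` in `Re z < 1 - δ`.
  let δ : ℝ := min 1 ((1 - z₀.re) / 2)
  have hδ : 0 < δ := lt_min one_pos (by linarith)
  have hδ1 : δ ≤ 1 := min_le_left _ _
  have hδ2 : δ ≤ (1 - z₀.re) / 2 := min_le_right _ _
  let s : Set ℂ := {z | z.re < 1 - δ}
  have hs : s ∈ 𝓝 z₀ :=
    (isOpen_lt Complex.continuous_re continuous_const).mem_nhds (show z₀.re < 1 - δ by linarith)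
  have hwm : AEStronglyMeasurable (fun t => (w t : ℂ)) ν := hw.ofReal.aestronglyMeasurable
  have hum : Measurable fun t => (u t : ℂ) := Complex.measurable_ofReal.comp hu
  have hm : ∀ z : ℂ, AEStronglyMeasurable (fun t => (w t : ℂ) / (1 - z * u t)) ν := fun z => by
    simp_rw [div_eq_mul_inv]
    exact hwm.mul (by fun_prop : Measurable fun t => (1 - z * (u t : ℂ))⁻¹).aestronglyMeasurable
  have hm' : AEStronglyMeasurable (fun t => (w t : ℂ) * u t / (1 - z₀ * u t) ^ 2) ν := by
    simp_rw [div_eq_mul_inv, mul_assoc]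
    exact hwm.mul
      (by fun_prop : Measurable fun t => (u t : ℂ) * ((1 - z₀ * (u t : ℂ)) ^ 2)⁻¹).aestronglyMeasurable
  have hint : Integrable (fun t => (w t : ℂ) / (1 - z₀ * u t)) ν := by
    refine (hw.norm.div_const δ).mono' (hm z₀) ?_
    filter_upwards [hu01] with t ht
    rw [norm_div, Complex.norm_real]
    gcongr
    exact min_one_le_norm_one_sub_mul hδ1 (by linarith) ht
  refine (hasDerivAt_integral_of_dominated_loc_of_deriv_le
    (F' := fun z t => (w t : ℂ) * u t / (1 - z * u t) ^ 2) (bound := fun t => ‖w t‖ / δ ^ 2)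
    hs (Eventually.of_forall hm) hint hm' ?_ (hw.norm.div_const _) ?_).2.differentiableAt
      |>.differentiableWithinAt
  · filter_upwards [hu01] with t ht z hz
    have hz : z.re < 1 - δ := hz
    rw [norm_div, norm_mul, Complex.norm_real, Complex.norm_real, norm_pow]
    gcongr
    · refine mul_le_of_le_one_right (norm_nonneg _) ?_
      rw [Real.norm_of_nonneg ht.1]; exact ht.2
    · exact min_one_le_norm_one_sub_mul hδ1 hz.le ht
  · filter_upwards [hu01] with t ht z hz
    have hz : z.re < 1 - δ := hz
    have hne : 1 - z * u t ≠ 0 :=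
      norm_pos_iff.1 (hδ.trans_le (min_one_le_norm_one_sub_mul hδ1 hz.le ht))
    have h1 : HasDerivAt (fun z : ℂ => 1 - z * u t) (-(u t : ℂ)) z := by
      simpa using ((hasDerivAt_id z).mul_const (u t : ℂ)).const_sub 1
    exact ((hasDerivAt_const z (w t : ℂ)).fun_div h1 hne).congr_deriv (by ring)

lemma analyticOnNhd_integral_div_one_sub_mul {ν : Measure α} {w u : α → ℝ} (hw : Integrable w ν)
    (hu : Measurable u) (hu01 : ∀ᵐ t ∂ν, u t ∈ Set.Icc (0 : ℝ) 1) :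
    AnalyticOnNhd ℝ (fun x : ℝ => ∫ t, w t / (1 - x * u t) ∂ν) (Set.Iio 1) := by
  intro x hx
  have hopen : IsOpen {z : ℂ | z.re < 1} := isOpen_lt Complex.continuous_re continuous_const
  have h1 := ((differentiableOn_integral_div_one_sub_mul hw hu hu01).analyticOnNhd hopen)
    (x : ℂ) (show (x : ℂ).re < 1 by simpa using hx)
  have h2 : AnalyticAt ℝ (fun y : ℝ => (∫ t, (w t : ℂ) / (1 - (y : ℂ) * u t) ∂ν).re) x :=
    (Complex.reCLM.analyticAt _).comp
      (AnalyticAt.fun_comp (f := fun y : ℝ => (y : ℂ)) (h1.restrictScalars (𝕜 := ℝ))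
        (Complex.ofRealCLM.analyticAt x))
  refine h2.congr (Eventually.of_forall fun y => ?_)
  have : ∀ t, (w t : ℂ) / (1 - (y : ℂ) * u t) = ((w t / (1 - y * u t) : ℝ) : ℂ) := by
    intro t; push_cast; rfl
  simp_rw [this]
  rw [integral_complex_ofReal, Complex.ofReal_re]

/-- Geometric expansion of the denominator, integrated term by term; the norms are dominated by a
geometric series of ratio `|x|`. -/
lemma hasSum_integral_div_one_sub_mul {ν : Measure α} {w u : α → ℝ} (hw : Integrable w ν)
    (hu : Measurable u) (hu01 : ∀ᵐ t ∂ν, u t ∈ Set.Icc (0 : ℝ) 1) {x : ℝ} (hx : |x| < 1) :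
    HasSum (fun n : ℕ => (∫ t, w t * u t ^ n ∂ν) * x ^ n) (∫ t, w t / (1 - x * u t) ∂ν) := by
  have hint : ∀ n : ℕ, Integrable (fun t => w t * u t ^ n) ν := fun n => by
    refine hw.norm.mono' (hw.aestronglyMeasurable.mul (hu.pow_const n).aestronglyMeasurable) ?_
    filter_upwards [hu01] with t ht
    rw [norm_mul, norm_pow, Real.norm_of_nonneg ht.1]
    exact mul_le_of_le_one_right (norm_nonneg _) (pow_le_one₀ ht.1 ht.2)
  have hle : ∀ n : ℕ, ∫ t, ‖w t * u t ^ n * x ^ n‖ ∂ν ≤ (∫ t, ‖w t‖ ∂ν) * |x| ^ n := fun n => by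
    rw [← integral_mul_const]
    refine integral_mono_ae ((hint n).mul_const _).norm (hw.norm.mul_const _) ?_
    filter_upwards [hu01] with t ht
    rw [norm_mul, norm_mul, norm_pow, norm_pow, Real.norm_of_nonneg ht.1, Real.norm_eq_abs x]
    gcongr
    exact mul_le_of_le_one_right (norm_nonneg _) (pow_le_one₀ ht.1 ht.2)
  have h := hasSum_integral_of_summable_integral_norm (μ := ν)
    (F := fun (n : ℕ) t => w t * u t ^ n * x ^ n) (fun n => (hint n).mul_const (x ^ n))
    (Summable.of_nonneg_of_le (fun n => integral_nonneg fun t => norm_nonneg _) hle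
      ((summable_geometric_of_lt_one (abs_nonneg x) hx).mul_left _))
  simp_rw [integral_mul_const] at h
  refine (integral_congr_ae ?_ : _ = ∫ t, w t / (1 - x * u t) ∂ν) ▸ h
  filter_upwards [hu01] with t ht
  have hxu : ‖x * u t‖ < 1 := by
    rw [norm_mul, Real.norm_of_nonneg ht.1, Real.norm_eq_abs]
    exact (mul_le_of_le_one_right (abs_nonneg x) ht.2).trans_lt hx
  have := (hasSum_geometric_of_norm_lt_one hxu).mul_left (w t)
  rw [div_eq_mul_inv, ← this.tsum_eq]
  refine tsum_congr fun n => ?_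
  rw [mul_pow, mul_assoc, mul_comm (u t ^ n)]

end ParametricIntegral

/-- Both sides are `(b)ₙ₊₁`. Hence `(b)ₙ / (b + 1)ₙ = b / (b + n)`, which collapses the
hypergeometric coefficients once `(1)ₙ` cancels `n!`. -/
lemma ascPochhammer_eval_add_one_mul (b : ℝ) (n : ℕ) :
    (ascPochhammer ℝ n).eval (b + 1) * b = (ascPochhammer ℝ n).eval b * (b + n) := by
  induction n with
  | zero => simp
  | succ n ih =>
    rw [ascPochhammer_succ_eval, ascPochhammer_succ_eval]
    push_cast
    linear_combination (b + 1 + n) * ih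

lemma ordinaryHypergeometric_one_add_one {b : ℝ} (hb : 0 < b) (x : ℝ) :
    ordinaryHypergeometric 1 b (b + 1) x = ∑' n : ℕ, b / (b + n) * x ^ n := by
  rw [ordinaryHypergeometric_eq_tsum]
  refine tsum_congr fun n => ?_
  have h1 := ascPochhammer_eval_add_one_mul b n
  have h2 : 0 < (ascPochhammer ℝ n).eval (b + 1) := ascPochhammer_pos n _ (by linarith)
  have h3 : (0 : ℝ) < b + n := by positivity
  have h4 : (n.factorial : ℝ) ≠ 0 := by positivity
  rw [ascPochhammer_eval_one, smul_eq_mul]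
  congr 1
  rw [inv_mul_cancel₀ h4, one_mul, ← div_eq_mul_inv, div_eq_div_iff h2.ne' h3.ne']
  linarith

/-- The function `₂F₁(1, 1 - 2/η; 2 - 2/η; x)` is an integral over the distances larger than
one. -/
theorem isHypergeometricContinuation_integral {η : ℝ} (hη : 2 < η) :
    IsHypergeometricContinuation 1 (1 - 2 / η) (2 - 2 / η)
      (fun x => (η - 2) * ∫ t in Set.Ioi (1 : ℝ), t ^ (1 - η) / (1 - x * t ^ (-η))) := by
  have hw : IntegrableOn (fun t : ℝ => t ^ (1 - η)) (Set.Ioi 1) :=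
    integrableOn_Ioi_rpow_of_lt (by linarith) one_pos
  have hu : Measurable fun t : ℝ => t ^ (-η) := by fun_prop
  have hu01 : ∀ᵐ t ∂(volume.restrict (Set.Ioi (1 : ℝ))), t ^ (-η) ∈ Set.Icc (0 : ℝ) 1 := by
    filter_upwards [ae_restrict_mem measurableSet_Ioi] with t ht
    have ht : (1 : ℝ) < t := ht
    exact ⟨by positivity, Real.rpow_le_one_of_one_le_of_nonpos ht.le (by linarith)⟩
  refine ⟨analyticOnNhd_const.mul (analyticOnNhd_integral_div_one_sub_mul hw hu hu01),
    fun x hx => ?_⟩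
  beta_reduce
  have hb : 0 < 1 - 2 / η := by
    rw [sub_pos, div_lt_one (by linarith)]; exact hη
  rw [show (2 : ℝ) - 2 / η = (1 - 2 / η) + 1 by ring, ordinaryHypergeometric_one_add_one hb,
    ← ((hasSum_integral_div_one_sub_mul hw hu hu01 hx).mul_left (η - 2)).tsum_eq]
  refine tsum_congr fun n => ?_
  -- The `n`-th moment; multiplied by `η - 2` it is `b / (b + n)` with `b = 1 - 2 / η`.
  have h1 : ∫ t in Set.Ioi (1 : ℝ), t ^ (1 - η) * (t ^ (-η)) ^ n = 1 / (η - 2 + η * n) := by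
    have h2 : ∀ t ∈ Set.Ioi (1 : ℝ), t ^ (1 - η) * (t ^ (-η)) ^ n = t ^ (1 - η - η * n) := by
      intro t ht
      have ht : (0 : ℝ) < t := one_pos.trans ht
      rw [← Real.rpow_natCast, ← Real.rpow_mul ht.le, ← Real.rpow_add ht]
      congr 1; ring
    have hn : 0 ≤ η * n := by positivity
    rw [setIntegral_congr_fun measurableSet_Ioi h2, integral_Ioi_rpow_of_lt (by linarith) one_pos,
      Real.one_rpow, neg_div, ← div_neg]
    congr 1; ring
  rw [h1]
  have hη0 : η ≠ 0 := by linarith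
  have hn : 0 ≤ η * n := by positivity
  have h3 : η - 2 + η * n ≠ 0 := by linarith
  have h4 : (1 - 2 / η) / (1 - 2 / η + n) = (η - 2) / (η - 2 + η * n) := by
    rw [← mul_div_mul_left _ _ hη0]
    congr 1 <;> field_simp
  rw [h4]; ring

/-- Ensures that the final exponent has the sign needed to leave `[0, ∞]` without truncation by
`ENNReal.ofReal`. -/
lemma gaussHypergeometric_nonneg_of_nonpos {η x : ℝ} (hη : 2 < η) (hx : x ≤ 0) :
    0 ≤ gaussHypergeometric 1 (1 - 2 / η) (2 - 2 / η) x := by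
  rw [(isHypergeometricContinuation_integral hη).gaussHypergeometric_eq (hx.trans_lt one_pos)]
  refine mul_nonneg (by linarith) (setIntegral_nonneg measurableSet_Ioi fun t ht => ?_)
  have ht : (0 : ℝ) < t := one_pos.trans ht
  have hu : 0 ≤ t ^ (-η) := by positivity
  exact div_nonneg (by positivity) (by linarith [mul_nonneg (neg_nonneg.2 hx) hu])

/-! ### The interference integral over the plane -/

lemma integrableOn_rpow_div_one_add {η a T : ℝ} (hη : 2 < η) (ha : 0 < a) (hT : 0 ≤ T) :
    IntegrableOn (fun y : ℝ => y * (T * y ^ (-η) / (1 + T * y ^ (-η)))) (Set.Ioi a) := by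
  have h := (integrableOn_Ioi_rpow_of_lt (show 1 - η < -1 by linarith) ha).const_mul T
  refine h.mono' (by fun_prop) ?_
  filter_upwards [ae_restrict_mem measurableSet_Ioi] with y hy
  have hy : 0 < y := ha.trans hy
  have hc : 0 ≤ T * y ^ (-η) := by positivity
  rw [Real.norm_of_nonneg (by positivity), sub_eq_add_neg, Real.rpow_add hy, Real.rpow_one]
  calc y * (T * y ^ (-η) / (1 + T * y ^ (-η))) ≤ y * (T * y ^ (-η)) := by
        gcongr
        exact div_le_self hc (by linarith)
    _ = T * (y * y ^ (-η)) := by ring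

/-- The substitution `y = a t`, which produces the hypergeometric argument `-T / a ^ η`. -/
lemma integral_Ioi_rpow_div_one_add {η a T : ℝ} (ha : 0 < a) :
    ∫ y in Set.Ioi a, y * (T * y ^ (-η) / (1 + T * y ^ (-η)))
      = T * a ^ (2 - η) * ∫ t in Set.Ioi (1 : ℝ), t ^ (1 - η) / (1 - -T / a ^ η * t ^ (-η)) := by
  have h := integral_comp_mul_left_Ioi' (fun y => y * (T * y ^ (-η) / (1 + T * y ^ (-η)))) 1 ha
  rw [mul_one] at h
  rw [← h, smul_eq_mul, ← integral_const_mul, ← integral_const_mul]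
  refine setIntegral_congr_fun measurableSet_Ioi fun t ht => ?_
  have ht : (0 : ℝ) < t := one_pos.trans ht
  have h1 : (a : ℝ) ^ (2 - η) = a * a * a ^ (-η) := by
    rw [sub_eq_add_neg, Real.rpow_add ha, Real.rpow_two]; ring
  have h2 : t ^ (1 - η) = t * t ^ (-η) := by
    rw [sub_eq_add_neg, Real.rpow_add ht, Real.rpow_one]
  have h3 : 1 - -T / a ^ η * t ^ (-η) = 1 + T * (a ^ (-η) * t ^ (-η)) := by
    rw [Real.rpow_neg ha.le]; ring
  rw [Real.mul_rpow ha.le ht.le, h1, h2, h3]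
  ring

/-- The integral, over the interfering region, of one minus the Laplace transform of the power
received from a device. -/
lemma lintegral_interfererIntensity {η lam R T : ℝ} (hη : 2 < η) (hlam : 0 ≤ lam) (hR : 0 < R)
    (hT : 0 ≤ T) :
    ∫⁻ v, ENNReal.ofReal (T * ‖v‖ ^ (-η) / (1 + T * ‖v‖ ^ (-η))) ∂(interfererIntensity lam R)
      = ENNReal.ofReal (2 * Real.pi * lam * (T * (√3 * R / 2) ^ (2 - η) / (η - 2)) *
          gaussHypergeometric 1 (1 - 2 / η) (2 - 2 / η) (-T / (√3 * R / 2) ^ η)) := by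
  have ha : 0 < √3 * R / 2 := by positivity
  unfold interfererIntensity
  set a := √3 * R / 2
  -- The radial profile, extended by zero inside the disc, so that integration in polar coordinates
  -- over the whole plane applies.
  let g : ℝ → ℝ := (Set.Ici a).indicator fun y => T * y ^ (-η) / (1 + T * y ^ (-η))
  have hg0 : ∀ y, 0 ≤ g y := fun y => Set.indicator_nonneg (fun y hy => by
    have : 0 < y := ha.trans_le hy
    positivity) y
  have hreg : MeasurableSet {v : Plane | a ≤ ‖v‖} := measurableSet_le (by fun_prop) (by fun_prop)
  have hyg : ∀ y : ℝ, y ^ (Module.finrank ℝ Plane - 1) • g y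
      = (Set.Ici a).indicator (fun y => y * (T * y ^ (-η) / (1 + T * y ^ (-η)))) y := by
    intro y
    rw [finrank_euclideanSpace_fin, smul_eq_mul, Set.indicator_mul_right]
    simp [g]
  have hsub : Set.Ici a ⊆ Set.Ioi 0 := fun y hy => ha.trans_le hy
  have hgint : Integrable (fun v : Plane => g ‖v‖) := by
    rw [integrable_fun_norm_addHaar]
    simp_rw [hyg]
    rw [integrableOn_indicator_iff measurableSet_Ici, Set.inter_eq_left.2 hsub, integrableOn_Ici_iff_integrableOn_Ioi]
    exact integrableOn_rpow_div_one_add hη ha hT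
  have hval : ∫ v : Plane, g ‖v‖ = 2 * Real.pi *
      (T * a ^ (2 - η) * ∫ t in Set.Ioi (1 : ℝ), t ^ (1 - η) / (1 - -T / a ^ η * t ^ (-η))) := by
    -- The factor `2 π` arises as the dimension times the area of the unit disc.
    rw [integral_fun_norm_addHaar volume g]
    simp_rw [hyg]
    rw [setIntegral_indicator measurableSet_Ici, Set.inter_eq_right.2 hsub, integral_Ici_eq_integral_Ioi,
      integral_Ioi_rpow_div_one_add ha, finrank_euclideanSpace_fin, measureReal_def,
      EuclideanSpace.volume_ball_fin_two]
    simp [Real.pi_pos.le]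
    ring
  have hlt : -T / a ^ η < 1 := by
    refine lt_of_le_of_lt (div_nonpos_of_nonpos_of_nonneg ?_ ?_) one_pos
    · linarith
    · positivity
  rw [lintegral_smul_measure, ← lintegral_indicator hreg,
    (isHypergeometricContinuation_integral hη).gaussHypergeometric_eq hlt]
  have hind : ∀ v : Plane, {v : Plane | a ≤ ‖v‖}.indicator
      (fun v => ENNReal.ofReal (T * ‖v‖ ^ (-η) / (1 + T * ‖v‖ ^ (-η)))) v
      = ENNReal.ofReal (g ‖v‖) := by
    intro v
    by_cases hv : a ≤ ‖v‖
    · rw [Set.indicator_of_mem (show v ∈ {v : Plane | a ≤ ‖v‖} from hv)]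
      simp only [g]
      rw [Set.indicator_of_mem (show ‖v‖ ∈ Set.Ici a from hv)]
    · rw [Set.indicator_of_notMem (show v ∉ {v : Plane | a ≤ ‖v‖} from hv)]
      simp only [g]
      rw [Set.indicator_of_notMem (show ‖v‖ ∉ Set.Ici a from hv), ENNReal.ofReal_zero]
  simp_rw [hind]
  rw [← ofReal_integral_eq_lintegral_ofReal hgint (ae_of_all _ fun v => hg0 _), smul_eq_mul,
    ← ENNReal.ofReal_mul hlam, hval]
  congr 1
  have : η - 2 ≠ 0 := by linarith
  generalize ∫ t in Set.Ioi (1 : ℝ), t ^ (1 - η) / (1 - -T / a ^ η * t ^ (-η)) = I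
  field_simp

/-! ### The interference of a Poisson field of interferers -/

/-- The normalized interference, with values in `[0, ∞]`, for given fading gains `f` and given
locations `x` of the interferers. -/
def interference (η : ℝ) (f : Option ℕ → ℝ) (x : ℕ → Plane) : ℝ≥0∞ :=
  ∑' i, ENNReal.ofReal (f (some i) * ‖x i‖ ^ (-η))

lemma measurable_interference (η : ℝ) :
    Measurable fun p : (Option ℕ → ℝ) × (ℕ → Plane) => interference η p.1 p.2 := by
  unfold interference
  refine Measurable.tsum fun i => ?_
  fun_prop

instance (lam R : ℝ) : SigmaFinite (interfererIntensity lam R) := by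
  unfold interfererIntensity
  rw [ENNReal.ofReal]
  exact SMul.sigmaFinite lam.toNNReal

lemma ofReal_mul_interference {T : ℝ} (hT : 0 ≤ T) (η : ℝ) (f : Option ℕ → ℝ) (x : ℕ → Plane) :
    ENNReal.ofReal T * interference η f x
      = ∑' i, ENNReal.ofReal (f (some i) * (T * ‖x i‖ ^ (-η))) := by
  rw [interference, ← ENNReal.tsum_mul_left]
  refine tsum_congr fun i => ?_
  rw [← ENNReal.ofReal_mul hT]
  congr 1; ring

lemma ae_pos_expMeasure : ∀ᵐ x ∂(expMeasure 1), 0 < x := by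
  have h1 := expMeasure_lt 0
  simp only [ENNReal.ofReal_pos, negExp_zero] at h1
  exact (prob_compl_eq_zero_iff measurableSet_Ioi).2 h1

lemma IsTwoDimPPPModel.ae_pos {Ω : Type*} [MeasurableSpace Ω] {μ : Measure Ω} {lam R : ℝ}
    {X : ℕ → Ω → Plane} {h : Option ℕ → Ω → ℝ} (hmodel : IsTwoDimPPPModel μ lam R X h) :
    ∀ᵐ ω ∂μ, ∀ k, 0 < h k ω :=
  ae_all_iff.2 fun k => ((hmodel.fading_law k).ae_iff (p := fun x => 0 < x)
    (measurableSet_Ioi (a := (0 : ℝ))).mem).2 ae_pos_expMeasure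

/-- A single point has intensity zero, so its count is Poisson of mean zero. At the origin this
keeps every received power positive. -/
lemma IsPoissonPointProcess.ae_ne {Ω : Type*} [MeasurableSpace Ω] {μ : Measure Ω} {lam R : ℝ}
    {X : ℕ → Ω → Plane} (hX : IsPoissonPointProcess X (interfererIntensity lam R) μ)
    (v : Plane) : ∀ᵐ ω ∂μ, ∀ i, X i ω ≠ v := by
  have h0 : interfererIntensity lam R {v} = 0 := by
    simp [interfererIntensity]
  have hp : ∀ᵐ n ∂((poissonMeasure 0).map (Nat.cast : ℕ → ℕ∞)), n = 0 := by
    rw [ae_map_iff (p := fun n : ℕ∞ => n = 0) measurable_from_top.aemeasurable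
      (measurableSet_singleton 0)]
    simp only [Nat.cast_eq_zero]
    have : poissonMeasure 0 {0} = 1 := by simp [poissonMeasure_singleton]
    exact (prob_compl_eq_zero_iff (measurableSet_singleton 0)).2 this
  have hlaw := hX.hasLaw_count {v} (measurableSet_singleton v) (by rw [h0]; simp)
  rw [h0, ENNReal.toNNReal_zero] at hlaw
  filter_upwards [(hlaw.ae_iff (p := fun n => n = 0) measurable_from_top).2 hp] with ω hω i hi
  rw [pointCount, Set.encard_eq_zero] at hω
  have : i ∈ {i : ℕ | X i ω ∈ ({v} : Set Plane)} := hi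
  rw [hω] at this
  exact this

/-! ### Joint law of fading and locations, and Laplace transform of the interference -/

section Model

variable {Ω : Type*} [MeasurableSpace Ω] {μ : Measure Ω} [IsProbabilityMeasure μ] {lam R : ℝ}
  {X : ℕ → Ω → Plane} {h : Option ℕ → Ω → ℝ}

lemma IsTwoDimPPPModel.hasLaw (hmodel : IsTwoDimPPPModel μ lam R X h) :
    HasLaw (fun ω => ((fun k => h k ω), (fun i => X i ω)))
      (fadingMeasure.prod (μ.map fun ω i => X i ω)) μ := by
  have hXm : Measurable fun ω i => X i ω := measurable_pi_lambda _ hmodel.locations.measurable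
  have hf : HasLaw (fun ω k => h k ω) fadingMeasure μ :=
    hmodel.fading_indep.hasLaw_infinitePi hmodel.fading_law
      (aemeasurable_pi_lambda _ fun k => (hmodel.fading_law k).aemeasurable)
  exact (indepFun_iff_hasLaw_prodMk_prod hf ⟨hXm.aemeasurable, rfl⟩).1
    hmodel.fading_indep_locations

/-- The Laplace transform of the interference. -/
lemma IsPoissonPointProcess.lintegral_negExp_interference
    (hX : IsPoissonPointProcess X (interfererIntensity lam R) μ) (η : ℝ) {T : ℝ} (hT : 0 ≤ T) :
    ∫⁻ p, negExp (ENNReal.ofReal T * interference η p.1 p.2)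
        ∂(fadingMeasure.prod (μ.map fun ω i => X i ω))
      = negExp (∫⁻ v, ENNReal.ofReal (T * ‖v‖ ^ (-η) / (1 + T * ‖v‖ ^ (-η)))
          ∂(interfererIntensity lam R)) := by
  have hXm : Measurable fun ω i => X i ω := measurable_pi_lambda _ hX.measurable
  have hQ := Measure.isProbabilityMeasure_map (μ := μ) hXm.aemeasurable
  have hc : ∀ v : Plane, 0 ≤ T * ‖v‖ ^ (-η) := fun v => by positivity
  have hlog : Measurable fun v : Plane => ENNReal.ofReal (Real.log (1 + T * ‖v‖ ^ (-η))) := by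
    fun_prop
  have hJ := measurable_interference η
  rw [lintegral_prod_symm _ (by fun_prop)]
  simp_rw [ofReal_mul_interference hT]
  have hinner : ∀ x : ℕ → Plane,
      ∫⁻ f, negExp (∑' i, ENNReal.ofReal (f (some i) * (T * ‖x i‖ ^ (-η)))) ∂fadingMeasure
        = negExp (∑' i, ENNReal.ofReal (Real.log (1 + T * ‖x i‖ ^ (-η)))) :=
    fun x => lintegral_fading_interference fun i => hc _
  simp_rw [hinner]
  -- The Laplace functional with `φ = log (1 + c)`, `c = T ‖v‖ ^ (-η)`; its integrand is `1 - 1 / (1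
  -- + c) = c / (1 + c)`.
  rw [lintegral_map (f := fun x : ℕ → Plane =>
    negExp (∑' i, ENNReal.ofReal (Real.log (1 + T * ‖x i‖ ^ (-η))))) (by fun_prop) hXm,
    hX.laplace hlog]
  congr 1
  refine lintegral_congr fun v => ?_
  have h1 : 0 < 1 + T * ‖v‖ ^ (-η) := by linarith [hc v]
  rw [negExp_ofReal (Real.log_nonneg (by linarith [hc v])), Real.exp_neg, Real.exp_log h1,
    ← ENNReal.ofReal_one, ← ENNReal.ofReal_sub _ (by positivity)]
  congr 1
  field_simp
  ring

/-- For `T > 0`, `e^(-T J)` vanishes where `J = ⊤`, so `E[e^(-T J)] ≤ P(J < ⊤)`. As `T → 0` the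
Poisson exponent tends to `0` and the left side to `1`. -/
lemma IsPoissonPointProcess.ae_interference_ne_top
    (hX : IsPoissonPointProcess X (interfererIntensity lam R) μ) {η : ℝ} (hη : 2 < η)
    (hlam : 0 ≤ lam) (hR : 0 < R) :
    ∀ᵐ p ∂(fadingMeasure.prod (μ.map fun ω i => X i ω)), interference η p.1 p.2 ≠ ⊤ := by
  have hXm : Measurable fun ω i => X i ω := measurable_pi_lambda _ hX.measurable
  have hQ := Measure.isProbabilityMeasure_map (μ := μ) hXm.aemeasurable
  set ν := fadingMeasure.prod (μ.map fun ω i => X i ω)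
  have hJ := measurable_interference η
  have hS : MeasurableSet {p : (Option ℕ → ℝ) × (ℕ → Plane) | interference η p.1 p.2 ≠ ⊤} :=
    (hJ (measurableSet_singleton ⊤)).compl
  let T : ℕ → ℝ := fun n => 1 / ((n : ℝ) + 1)
  have hT : ∀ n, 0 < T n := fun n => by positivity
  have hT1 : ∀ n, T n ≤ 1 := fun n => by
    rw [div_le_one (by positivity)]; linarith [Nat.cast_nonneg (α := ℝ) n]
  let C : ℝ → ℝ≥0∞ := fun t =>
    ∫⁻ v, ENNReal.ofReal (t * ‖v‖ ^ (-η) / (1 + t * ‖v‖ ^ (-η))) ∂(interfererIntensity lam R)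
  have hle : ∀ n, negExp (C (T n)) ≤ ν {p | interference η p.1 p.2 ≠ ⊤} := by
    intro n
    rw [← hX.lintegral_negExp_interference η (hT n).le, ← lintegral_indicator_one hS]
    refine lintegral_mono fun p => ?_
    by_cases hp : interference η p.1 p.2 = ⊤
    · rw [hp, ENNReal.mul_top (by simpa using hT n)]
      simp
    · rw [Set.indicator_of_mem (show p ∈ {p : (Option ℕ → ℝ) × (ℕ → Plane) |
        interference η p.1 p.2 ≠ ⊤} from hp)]
      exact negExp_le_one _
  have hlim : Tendsto (fun n => C (T n)) atTop (𝓝 0) := by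
    rw [← lintegral_zero (μ := interfererIntensity lam R)]
    -- The integrand increases with `T`, so its value at `T = 1` dominates; that integral is finite
    -- by its closed form.
    refine tendsto_lintegral_of_dominated_convergence
      (fun v => ENNReal.ofReal (1 * ‖v‖ ^ (-η) / (1 + 1 * ‖v‖ ^ (-η)))) (fun n => by fun_prop)
      (fun n => ae_of_all _ fun v => ENNReal.ofReal_le_ofReal ?_) ?_ (ae_of_all _ fun v => ?_)
    · have hv : 0 ≤ ‖v‖ ^ (-η) := by positivity
      have := (hT n).le
      rw [div_le_div_iff₀ (by positivity) (by positivity)]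
      nlinarith [hT1 n, mul_le_mul_of_nonneg_right (hT1 n) hv]
    · rw [lintegral_interfererIntensity hη hlam hR zero_le_one]
      exact ENNReal.ofReal_ne_top
    · rw [← ENNReal.ofReal_zero]
      refine (ENNReal.continuous_ofReal.tendsto 0).comp ?_
      have h0 : Tendsto (fun n => T n * ‖v‖ ^ (-η)) atTop (𝓝 0) := by
        simpa [T] using (tendsto_one_div_add_atTop_nhds_zero_nat (𝕜 := ℝ)).mul_const (‖v‖ ^ (-η))
      have h1 := h0.div (h0.const_add 1) (by simp)
      rwa [zero_div] at h1
  have hone : 1 ≤ ν {p | interference η p.1 p.2 ≠ ⊤} := by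
    have h1 := (continuous_negExp.tendsto 0).comp hlim
    rw [negExp_zero] at h1
    exact le_of_tendsto' h1 hle
  have h1 : ν {p | interference η p.1 p.2 ≠ ⊤} = 1 := le_antisymm prob_le_one hone
  exact (prob_compl_eq_zero_iff hS).2 h1

lemma IsTwoDimPPPModel.ae_interference_ne_top (hmodel : IsTwoDimPPPModel μ lam R X h) {η : ℝ}
    (hη : 2 < η) (hlam : 0 ≤ lam) (hR : 0 < R) :
    ∀ᵐ ω ∂μ, interference η (fun k => h k ω) (fun i => X i ω) ≠ ⊤ := by
  have hS : MeasurableSet {p : (Option ℕ → ℝ) × (ℕ → Plane) | interference η p.1 p.2 ≠ ⊤} :=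
    (measurable_interference η (measurableSet_singleton ⊤)).compl
  exact (hmodel.hasLaw.ae_iff (p := fun p => interference η p.1 p.2 ≠ ⊤) hS.mem).2
    (hmodel.locations.ae_interference_ne_top hη hlam hR)

/-- The probability that the fading gain exceeds the noise plus the scaled interference. -/
lemma IsTwoDimPPPModel.measure_lt_fading (hmodel : IsTwoDimPPPModel μ lam R X h) (η : ℝ) {A T : ℝ}
    (hA : 0 ≤ A) (hT : 0 ≤ T) :
    μ {ω | ENNReal.ofReal A + ENNReal.ofReal T * interference η (fun k => h k ω) (fun i => X i ω)
        < ENNReal.ofReal (h none ω)}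
      = ENNReal.ofReal (Real.exp (-A)) *
        negExp (∫⁻ v, ENNReal.ofReal (T * ‖v‖ ^ (-η) / (1 + T * ‖v‖ ^ (-η)))
          ∂(interfererIntensity lam R)) := by
  have hXm : Measurable fun ω i => X i ω := measurable_pi_lambda _ hmodel.locations.measurable
  have hQ := Measure.isProbabilityMeasure_map (μ := μ) hXm.aemeasurable
  have hJ := measurable_interference η
  have hS : MeasurableSet {p : (Option ℕ → ℝ) × (ℕ → Plane) |
      ENNReal.ofReal A + ENNReal.ofReal T * interference η p.1 p.2 < ENNReal.ofReal (p.1 none)} :=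
    measurableSet_lt (by fun_prop) (by fun_prop)
  rw [← hmodel.locations.lintegral_negExp_interference η hT, ← negExp_ofReal hA,
    ← lintegral_const_mul _ (by fun_prop)]
  simp_rw [← negExp_add]
  rw [lintegral_prod_symm _ (by fun_prop)]
  have h1 := hmodel.hasLaw.measure_eq (p := fun p : (Option ℕ → ℝ) × (ℕ → Plane) =>
    ENNReal.ofReal A + ENNReal.ofReal T * interference η p.1 p.2 < ENNReal.ofReal (p.1 none)) hS
  rw [h1, Measure.prod_apply_symm hS]
  refine lintegral_congr fun x => ?_
  have hY : Measurable fun g : ℕ → ℝ => ENNReal.ofReal A +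
      ENNReal.ofReal T * ∑' i, ENNReal.ofReal (g i * ‖x i‖ ^ (-η)) := by fun_prop
  exact fadingMeasure_lt hY

end Model

/-- A pathwise rearrangement: finiteness of `J` in `[0, ∞]` gives real summability, after which the
inequality is cleared of denominators. -/
lemma lt_sinr_iff {Ω : Type*} {P η σ ro Ξ : ℝ} {X : ℕ → Ω → Plane} {h : Option ℕ → Ω → ℝ} {ω : Ω}
    (hP : 0 < P) (hro : 0 < ro) (hΞ : 0 ≤ Ξ) (hh : ∀ k, 0 < h k ω) (hX : ∀ i, X i ω ≠ 0)
    (hJ : interference η (fun k => h k ω) (fun i => X i ω) ≠ ⊤) :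
    Summable (interferencePower P η X h ω) ∧ (Ξ < sinr P η σ ro X h ω ↔
      ENNReal.ofReal (Ξ * ro ^ η * σ ^ 2 / P) + ENNReal.ofReal (Ξ * ro ^ η) *
        interference η (fun k => h k ω) (fun i => X i ω) < ENNReal.ofReal (h none ω)) := by
  have hpos : ∀ i, 0 < h (some i) ω * ‖X i ω‖ ^ (-η) := fun i =>
    mul_pos (hh _) (Real.rpow_pos_of_pos (norm_pos_iff.2 (hX i)) _)
  have hs : Summable fun i => h (some i) ω * ‖X i ω‖ ^ (-η) := by
    have := ENNReal.summable_toReal hJ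
    refine this.congr fun i => ENNReal.toReal_ofReal (hpos i).le
  have hs' : Summable (interferencePower P η X h ω) := by
    refine (hs.mul_left P).congr fun i => ?_
    rw [interferencePower, mul_assoc]
  refine ⟨hs', ?_⟩
  have hI : ∑' i, interferencePower P η X h ω i
      = P * ∑' i, h (some i) ω * ‖X i ω‖ ^ (-η) := by
    rw [← tsum_mul_left]
    refine tsum_congr fun i => ?_
    rw [interferencePower, mul_assoc]
  have hJ' : interference η (fun k => h k ω) (fun i => X i ω)
      = ENNReal.ofReal (∑' i, h (some i) ω * ‖X i ω‖ ^ (-η)) :=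
    (ENNReal.ofReal_tsum_of_nonneg (fun i => (hpos i).le) hs).symm
  -- Strict positivity matters because `σ` may be zero; otherwise the quotient could be a division
  -- by zero.
  have hJpos : 0 < ∑' i, h (some i) ω * ‖X i ω‖ ^ (-η) := hs.tsum_pos (fun i => (hpos i).le) 0 (hpos 0)
  rw [sinr, hI, hJ']
  generalize ∑' i, h (some i) ω * ‖X i ω‖ ^ (-η) = J at hJpos
  have hr : 0 < ro ^ η := by positivity
  rw [← ENNReal.ofReal_mul (by positivity), ← ENNReal.ofReal_add (by positivity) (by positivity),
    ENNReal.ofReal_lt_ofReal_iff (hh none), lt_div_iff₀ (by positivity), Real.rpow_neg hro.le,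
    ← div_eq_mul_inv, lt_div_iff₀ hr]
  have : (Ξ * ro ^ η * σ ^ 2 / P + Ξ * ro ^ η * J) = Ξ * (σ ^ 2 + P * J) * ro ^ η / P := by
    field_simp
  rw [this, div_lt_iff₀ hP, mul_comm P (h none ω)]

lemma sinrThreshold_nonneg {L ζ W Ts : ℝ} {m : ℕ} (hL : 0 ≤ L) (hζ : 0 ≤ ζ) (hW : 0 ≤ W)
    (hTs : 0 ≤ Ts) : 0 ≤ sinrThreshold L m ζ W Ts :=
  sub_nonneg.2 (Real.one_le_rpow one_le_two (by positivity))

end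

/-! ### The success probability in closed form -/

theorem corollary4 {Ω : Type*} [MeasurableSpace Ω] (μ : Measure Ω) [IsProbabilityMeasure μ]
    (Δx Δy R P η σ ro L ζ W Ts : ℝ) (NG m : ℕ)
    (hΔx : 0 < Δx) (hΔy : 0 < Δy) (hR : 0 < R) (hNG : 0 < NG) (hP : 0 < P) (hη : 2 < η)
    (hro : 0 < ro) (hL : 0 < L) (hm : 0 < m) (hζ : 0 < ζ) (hζ1 : ζ ≤ 1) (hW : 0 < W)
    (hTs : 0 < Ts)
    (X : ℕ → Ω → Plane) (h : Option ℕ → Ω → ℝ)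
    (hmodel : IsTwoDimPPPModel μ (activeDensity Δx Δy NG) R X h) :
    (∀ᵐ ω ∂μ, Summable (interferencePower P η X h ω)) ∧
    successProb μ P η σ ro (sinrThreshold L m ζ W Ts) X h =
      Real.exp
        (-(sinrThreshold L m ζ W Ts * ro ^ η * σ ^ 2 / P)
          - 2 * Real.pi * sinrThreshold L m ζ W Ts * ro ^ η * (√3 * R / 2) ^ (2 - η)
              / (Δx * Δy * NG * (η - 2))
            * gaussHypergeometric 1 (1 - 2 / η) (2 - 2 / η)
                (-(sinrThreshold L m ζ W Ts * ro ^ η) / (√3 * R / 2) ^ η)) := by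
  have hlam : 0 ≤ activeDensity Δx Δy NG := by unfold activeDensity; positivity
  have hΞ : 0 ≤ sinrThreshold L m ζ W Ts := sinrThreshold_nonneg hL.le hζ.le hW.le hTs.le
  set Ξ := sinrThreshold L m ζ W Ts
  have hae : ∀ᵐ ω ∂μ, Summable (interferencePower P η X h ω) ∧ (Ξ < sinr P η σ ro X h ω ↔
      ENNReal.ofReal (Ξ * ro ^ η * σ ^ 2 / P) + ENNReal.ofReal (Ξ * ro ^ η) *
        interference η (fun k => h k ω) (fun i => X i ω) < ENNReal.ofReal (h none ω)) := by
    filter_upwards [hmodel.ae_pos, hmodel.locations.ae_ne 0,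
      hmodel.ae_interference_ne_top hη hlam hR] with ω h1 h2 h3
    exact lt_sinr_iff hP hro hΞ h1 h2 h3
  refine ⟨hae.mono fun ω hω => hω.1, ?_⟩
  have hr : 0 < ro ^ η := by positivity
  have hT : 0 ≤ Ξ * ro ^ η := by positivity
  have ha : 0 < √3 * R / 2 := by positivity
  have hset : {ω | Ξ < sinr P η σ ro X h ω} =ᵐ[μ] {ω | ENNReal.ofReal (Ξ * ro ^ η * σ ^ 2 / P) +
      ENNReal.ofReal (Ξ * ro ^ η) * interference η (fun k => h k ω) (fun i => X i ω)
        < ENNReal.ofReal (h none ω)} := hae.mono fun ω hω => propext hω.2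
  rw [successProb, measureReal_def, measure_congr hset,
    hmodel.measure_lt_fading η (by positivity) hT, lintegral_interfererIntensity hη hlam hR hT]
  have hF : 0 ≤ gaussHypergeometric 1 (1 - 2 / η) (2 - 2 / η)
      (-(Ξ * ro ^ η) / (√3 * R / 2) ^ η) := by
    refine gaussHypergeometric_nonneg_of_nonpos hη (div_nonpos_of_nonpos_of_nonneg ?_ ?_)
    · linarith
    · positivity
  have hη2 : 0 < η - 2 := by linarith
  rw [negExp_ofReal (by positivity), ← ENNReal.ofReal_mul (by positivity), ← Real.exp_add,
    ENNReal.toReal_ofReal (by positivity), activeDensity]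
  congr 1
  generalize gaussHypergeometric _ _ _ _ = F
  rw [sub_eq_add_neg]
  congr 2
  field_simp
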